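/- Let $\kappa\colon[0,1]^2\to[0,1]$ be a graphon, i.e. measurable and symmetric, and assume that $\kappa$ is continuous and that $\mathcal D(x)=\int_{[0,1]}\kappa(x,y)\,\mathrm dy>0$ for every $x\in[0,1]$. Let $$\mathcal T(x)=\tfrac12\int_{[0,1]^2}\kappa(x,y)\,\kappa(y,z)\,\kappa(z,x)\,\mathrm dy\,\mathrm dz .$$ For $n\ge1$ let $G(n,\kappa)$ be the random simple graph on the vertex set $[n]=\{1,\dots,n\}$ in which the pairs of distinct vertices are connected independently of one another, the vertices $i=\lceil xn\rceil$ and $j=\lceil yn\rceil$ being connected with probability $\kappa(x,y)$. (For each $n$ and each pair $i<j$ the representatives $x,y\in[0,1]$ with $\lceil xn\rceil=i$ and $\lceil yn\rceil=j$ are fixed arbitrarily, for example $x=i/n$, $y=j/n$.) Let the graphs $G(n,\kappa)$, $n\ge1$, be defined on a common probability space with probability measure $\mathbb P$, with an arbitrary joint distribution. For a simple graph on $[n]$ with adjacency matrix $(A_{ij})$, let $d_i$ be the degree of the vertex $i$ and $t_i$ the number of triangles that contain $i$, and put $$\Delta^T_{i,n}=\Big[\frac1{d_i}\sum_{j\in[n]}A_{ij}t_j-t_i\Big]\mathbf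 1_{\{d_i\neq0\}},\qquad \Delta^T_{[n]}=\frac1n\sum_{i\in[n]}\Delta^T_{i,n}.$$ If $\Delta^T_{[n]}$ denotes this quantity for the graph $G(n,\kappa)$, then $$\lim_{n\to\infty}n^{-2}\Delta^T_{[n]}=\chi^T:=\int_{[0,1]}\Big[\frac1{\mathcal D(x)}\int_{[0,1]}\kappa(x,y)\,\mathcal T(y)\,\mathrm dy-\mathcal T(x)\Big]\mathrm dx\qquad\mathbb P\text{-almost surely.}$$ -/

import Mathlib

open MeasureTheory ProbabilityTheory Filter Topology

/-- A graphon: a measurable symmetric function `[0,1]² → [0,1]`. -/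
structure Graphon where
  toFun : unitInterval → unitInterval → unitInterval
  measurable_toFun : Measurable (Function.uncurry toFun)
  symm_toFun : ∀ x y, toFun x y = toFun y x

/-- The real number `κ(x,y)`. -/
def Graphon.val (κ : Graphon) (x y : unitInterval) : ℝ := (κ.toFun x y : ℝ)

/-- The degree density `D(x) = ∫ κ(x,y) dy`. -/
noncomputable def Graphon.degreeDensity (κ : Graphon) (x : unitInterval) : ℝ :=
  ∫ y : unitInterval, κ.val x y

/-- The triangle density `T(x) = ½ ∫∫ κ(x,y) κ(y,z) κ(z,x) dy dz`. -/
noncomputable def Graphon.triangleDensity (κ : Graphon) (x : unitInterval) : ℝ :=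
  (1 / 2 : ℝ) * ∫ p : unitInterval × unitInterval, κ.val x p.1 * κ.val p.1 p.2 * κ.val p.2 x

/-- The limiting bias `χ^T = ∫ [D(x)⁻¹ ∫ κ(x,y) T(y) dy - T(x)] dx`. -/
noncomputable def Graphon.chiT (κ : Graphon) : ℝ :=
  ∫ x : unitInterval,
    ((κ.degreeDensity x)⁻¹ * (∫ y : unitInterval, κ.val x y * κ.triangleDensity y)
      - κ.triangleDensity x)

/-- The number `t_i` of triangles of `G` that contain the vertex `i`. -/
noncomputable def triangleCount {n : ℕ} (G : SimpleGraph (Fin n)) (i : Fin n) : ℕ :=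
  {s : Finset (Fin n) | G.IsNClique 3 s ∧ i ∈ s}.ncard

open Classical in
/-- The triangle friendship-bias `[d_i⁻¹ ∑_j A_ij t_j - t_i] 1_{d_i ≠ 0}` of the vertex `i`. -/
noncomputable def triangleBias {n : ℕ} (G : SimpleGraph (Fin n)) (i : Fin n) : ℝ :=
  if G.degree i = 0 then 0
  else (G.degree i : ℝ)⁻¹ * ∑ j : Fin n, G.adjMatrix ℝ i j * (triangleCount G j : ℝ)
    - (triangleCount G i : ℝ)

/-- The triangle friendship-bias of the graph, i.e. the average over the vertices. -/
noncomputable def avgTriangleBias {n : ℕ} (G : SimpleGraph (Fin n)) : ℝ :=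
  (n : ℝ)⁻¹ * ∑ i : Fin n, triangleBias G i

/-- `G` is an inhomogeneous random graph `G(n, κ)` under `P`: the edges are present independently
of one another, and the vertices `i = ⌈xn⌉` and `j = ⌈yn⌉`, `i ≠ j`, are connected with probability
`κ(x,y)`. The vertex `i ∈ {1,…,n}` is the element of `Fin n` with value `i - 1`. For each pair of
vertices any representatives `x` and `y` are allowed (for example `x = i/n` and `y = j/n`). -/
structure IsInhomogeneousRandomGraph {Ω : Type*} [MeasurableSpace Ω] (κ : Graphon) (n : ℕ)
    (G : Ω → SimpleGraph (Fin n)) (P : Measure Ω) : Prop where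
  measurableSet_adj : ∀ i j : Fin n, MeasurableSet {ω | (G ω).Adj i j}
  indep : iIndepSet (fun e : {e : Fin n × Fin n // e.1 < e.2} =>
    {ω | (G ω).Adj e.1.1 e.1.2}) P
  edge_prob : ∀ i j : Fin n, i < j → ∃ x y : unitInterval,
    ⌈(x : ℝ) * n⌉₊ = (i : ℕ) + 1 ∧ ⌈(y : ℝ) * n⌉₊ = (j : ℕ) + 1 ∧
      P {ω | (G ω).Adj i j} = ENNReal.ofReal (κ.val x y)

/-!
The proof compares the adjacency matrix `A` of `G(n, κ)` with the sampled matrix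
`q i j = κ((i + 1) / n, (j + 1) / n)` in the cut norm, and uses that the averaged triangle bias is
continuous in that norm as long as the degree densities are bounded below.

* Probability enters once. For fixed sign vectors `s`, `t` the sum `∑ s i * t j * (A i j - 𝔼 A i j)`
  is a sum of independent bounded centred variables, one for each pair `i < j`, so Hoeffding's
  inequality bounds the probability that it exceeds `η n²` by `exp (-η² n² / 8)`. This beats the
  number `9 ^ n` of pairs of sign vectors, and the Borel–Cantelli lemma gives
  `ae_eventually_cutBound` for any coupling of the graphs. By uniform continuity of `κ`, `𝔼 A` may
  be replaced by `q`.
* The rest is deterministic (`sum_triangleBias_approx`). Small cut norm makes the degrees close to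
  `n D` on average. Weighted triangle sums are stable under it (`triangle_counting`). Replacing
  `1 / d_i` by `1 / (n D)` costs at most `|d_i - n D| n / (2 c)` with `c = min D > 0`, since
  `∑ j, A i j * t_j ≤ d_i n² / 2`; thus no uniform control of the degrees is needed.
* With `A` replaced by `q`, the normalised bias is a four-dimensional Riemann sum of the continuous
  function `Graphon.biasKernel`, whose integral is `χ^T` (`tendsto_riemannSum`,
  `Graphon.chiT_eq_integral_biasKernel`).
-/

/-! ### Triangle counts and the adjacency matrix -/

open Classical in
theorem sum_adj_triangle_eq {n : ℕ} (G : SimpleGraph (Fin n)) (j : Fin n) :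
    ∑ k, ∑ l, G.adjMatrix ℝ j k * G.adjMatrix ℝ k l * G.adjMatrix ℝ l j
      = 2 * (triangleCount G j : ℝ) := by
  set S : Finset (Finset (Fin n)) := {s | G.IsNClique 3 s ∧ j ∈ s} with hS
  set E : Finset (Fin n × Fin n) := {e | G.Adj j e.1 ∧ G.Adj e.1 e.2 ∧ G.Adj e.2 j} with hE
  have hT : triangleCount G j = S.card := by
    rw [triangleCount, ← Set.ncard_coe_finset]
    congr 1
    ext s
    simp [hS]
  have hcard : E.card = S.card * 2 := by
    refine Finset.card_eq_sum_card_fiberwise (f := fun e => ({j, e.1, e.2} : Finset (Fin n)))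
      (t := S) ?_ |>.trans ?_
    · rintro ⟨a, b⟩ he
      simp only [hE, Finset.coe_filter, Finset.mem_univ, true_and, Set.mem_ofPred_eq] at he
      simp only [hS, Finset.coe_filter, Finset.mem_univ, true_and, Set.mem_ofPred_eq]
      exact ⟨SimpleGraph.is3Clique_triple_iff.2 ⟨he.1, he.2.2.symm, he.2.1⟩, by simp⟩
    · rw [Finset.sum_const_nat]
      intro s hs
      simp only [hS, Finset.mem_filter, Finset.mem_univ, true_and] at hs
      obtain ⟨a, b, hab, hja, hjb, hs'⟩ : ∃ a b, G.Adj a b ∧ G.Adj j a ∧ G.Adj j b ∧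
          s = {j, a, b} := by
        obtain ⟨x, y, z, hxy, hxz, hyz, rfl⟩ := SimpleGraph.is3Clique_iff.1 hs.1
        have := hs.2
        simp only [Finset.mem_insert, Finset.mem_singleton] at this
        rcases this with rfl | rfl | rfl
        · exact ⟨y, z, hyz, hxy, hxz, rfl⟩
        · exact ⟨x, z, hxz, hxy.symm, hyz, by grind⟩
        · exact ⟨x, y, hxy, hxz.symm, hyz.symm, by grind⟩
      have hfib : {e ∈ E | ({j, e.1, e.2} : Finset (Fin n)) = s} = {(a, b), (b, a)} := by
        have h1 := hab.ne
        have h2 := hja.ne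
        have h3 := hjb.ne
        ext ⟨x, y⟩
        simp only [hE, Finset.mem_filter, Finset.mem_univ, true_and, Finset.mem_insert,
          Finset.mem_singleton, Prod.mk.injEq]
        constructor
        · rintro ⟨⟨e1, e2, e3⟩, h⟩
          have hx : x ∈ s := by rw [← h]; simp
          have hy : y ∈ s := by rw [← h]; simp
          rw [hs'] at hx hy
          simp only [Finset.mem_insert, Finset.mem_singleton] at hx hy
          have := e1.ne
          have := e2.ne
          have := e3.ne
          grind
        · rintro (⟨rfl, rfl⟩ | ⟨rfl, rfl⟩)
          · exact ⟨⟨hja, hab, hjb.symm⟩, hs'.symm⟩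
          · exact ⟨⟨hjb, hab.symm, hja.symm⟩, by rw [hs']; grind⟩
      rw [hfib, Finset.card_pair]
      simp [hab.ne]
  have hsum : ∑ k, ∑ l, G.adjMatrix ℝ j k * G.adjMatrix ℝ k l * G.adjMatrix ℝ l j
      = (E.card : ℝ) := by
    rw [← Fintype.sum_prod_type', hE, Finset.card_filter]
    push_cast
    refine Finset.sum_congr rfl fun e _ => ?_
    simp only [SimpleGraph.adjMatrix_apply]
    by_cases h1 : G.Adj j e.1 <;> by_cases h2 : G.Adj e.1 e.2 <;> by_cases h3 : G.Adj e.2 j <;>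
      simp [h1, h2, h3]
  rw [hsum, hcard, hT]
  push_cast
  ring

/-! ### Stability of the bias under perturbations that are small in the cut norm -/

/-- The cut norm of the matrix `M`, normalised by `n²`, is at most `η`. It is encoded through the
bilinear form of `M` on vectors with entries in `[-1, 1]`, which differs from the usual supremum
over pairs of vertex sets by at most a factor `4`. -/
def CutBound {n : ℕ} (M : Fin n → Fin n → ℝ) (η : ℝ) : Prop :=
  ∀ a b : Fin n → ℝ, (∀ i, |a i| ≤ 1) → (∀ i, |b i| ≤ 1) →
    |∑ i, ∑ j, a i * b j * M i j| ≤ η * (n : ℝ) ^ 2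

/-- The weight `∑ k, ∑ l, B j k * B k l * B l j` of the rooted triangles at `j`. -/
def triangleWeight {n : ℕ} (B : Fin n → Fin n → ℝ) (j : Fin n) : ℝ :=
  ∑ k, ∑ l, B j k * B k l * B l j

theorem abs_mul_le_one {a b : ℝ} (ha : |a| ≤ 1) (hb : |b| ≤ 1) : |a * b| ≤ 1 := by
  rw [abs_mul]
  exact mul_le_one₀ ha (abs_nonneg _) hb

theorem abs_sum_le_card_mul {n : ℕ} {f : Fin n → ℝ} {C : ℝ} (h : ∀ i, |f i| ≤ C) :
    |∑ i, f i| ≤ n * C := by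
  refine (Finset.abs_sum_le_sum_abs _ _).trans ((Finset.sum_le_card_nsmul _ _ C
    fun i _ => h i).trans ?_)
  simp

theorem triangleWeight_mem {n : ℕ} {B : Fin n → Fin n → ℝ}
    (hB : ∀ i j, B i j ∈ Set.Icc (0 : ℝ) 1) (j : Fin n) :
    triangleWeight B j ∈ Set.Icc (0 : ℝ) ((n : ℝ) ^ 2) := by
  have h0 : ∀ i j, 0 ≤ B i j := fun i j => (hB i j).1
  have h1 : ∀ i j, |B i j| ≤ 1 := fun i j => by
    rw [abs_of_nonneg (h0 i j)]
    exact (hB i j).2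
  constructor
  · exact Finset.sum_nonneg fun k _ => Finset.sum_nonneg fun l _ =>
      mul_nonneg (mul_nonneg (h0 _ _) (h0 _ _)) (h0 _ _)
  · refine (le_abs_self _).trans ((abs_sum_le_card_mul (C := n * 1) fun k =>
      abs_sum_le_card_mul fun l => abs_mul_le_one (abs_mul_le_one (h1 _ _) (h1 _ _))
        (h1 _ _)).trans ?_)
    apply le_of_eq
    ring

theorem CutBound.row_sums {n : ℕ} {M : Fin n → Fin n → ℝ} {η : ℝ} (h : CutBound M η) :
    ∑ i, |∑ j, M i j| ≤ η * (n : ℝ) ^ 2 := by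
  have h1 := h (fun i => SignType.sign (∑ j, M i j)) (fun _ => 1) (fun i => by
    rcases lt_trichotomy (∑ j, M i j) 0 with h | h | h <;> simp [h]) (by simp)
  refine le_trans (le_of_eq ?_) ((le_abs_self _).trans h1)
  refine Finset.sum_congr rfl fun i _ => ?_
  simp only [mul_one]
  rw [← Finset.mul_sum, sign_mul_self]

/-- Counting lemma for triangles: replacing the three factors one at a time, each difference is a
sum over one vertex of evaluations of the bilinear form of `A - q`. -/
theorem triangle_counting {n : ℕ} {A q : Fin n → Fin n → ℝ} {η : ℝ}
    (hA : ∀ i j, |A i j| ≤ 1) (hq : ∀ i j, |q i j| ≤ 1)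
    (h : CutBound (fun i j => A i j - q i j) η) {r : Fin n → ℝ} (hr : ∀ j, |r j| ≤ 1) :
    |∑ j, r j * triangleWeight A j - ∑ j, r j * triangleWeight q j| ≤ 3 * η * (n : ℝ) ^ 3 := by
  have e1 : |∑ l, ∑ j, ∑ k, (r j * A l j) * A k l * (A j k - q j k)| ≤ n * (η * (n : ℝ) ^ 2) :=
    abs_sum_le_card_mul fun l => h _ _ (fun j => abs_mul_le_one (hr _) (hA _ _)) fun k => hA _ _
  have e2 : |∑ j, ∑ k, ∑ l, (r j * q j k) * A l j * (A k l - q k l)| ≤ n * (η * (n : ℝ) ^ 2) :=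
    abs_sum_le_card_mul fun j => h _ _ (fun k => abs_mul_le_one (hr _) (hq _ _)) fun l => hA _ _
  have e3 : |∑ k, ∑ l, ∑ j, q k l * (r j * q j k) * (A l j - q l j)| ≤ n * (η * (n : ℝ) ^ 2) :=
    abs_sum_le_card_mul fun k => h _ _ (fun l => hq _ _) fun j => abs_mul_le_one (hr _) (hq _ _)
  have key : ∑ j, r j * triangleWeight A j - ∑ j, r j * triangleWeight q j
      = (∑ l, ∑ j, ∑ k, (r j * A l j) * A k l * (A j k - q j k))
        + (∑ j, ∑ k, ∑ l, (r j * q j k) * A l j * (A k l - q k l))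
        + ∑ k, ∑ l, ∑ j, q k l * (r j * q j k) * (A l j - q l j) := by
    have c1 : (∑ l, ∑ j, ∑ k, (r j * A l j) * A k l * (A j k - q j k))
        = ∑ j, ∑ k, ∑ l, (r j * A l j) * A k l * (A j k - q j k) := by
      rw [Finset.sum_comm]
      exact Finset.sum_congr rfl fun j _ => Finset.sum_comm
    have c3 : (∑ k, ∑ l, ∑ j, q k l * (r j * q j k) * (A l j - q l j))
        = ∑ j, ∑ k, ∑ l, q k l * (r j * q j k) * (A l j - q l j) := by
      rw [Finset.sum_comm' (t' := Finset.univ) (s' := fun _ => Finset.univ) (by simp),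
        Finset.sum_congr rfl fun l _ => Finset.sum_comm, Finset.sum_comm]
      exact Finset.sum_congr rfl fun l _ => Finset.sum_comm
    rw [c1, c3]
    simp only [triangleWeight, Finset.mul_sum, ← Finset.sum_add_distrib, ← Finset.sum_sub_distrib]
    refine Finset.sum_congr rfl fun j _ => Finset.sum_congr rfl fun k _ =>
      Finset.sum_congr rfl fun l _ => ?_
    ring
  rw [key]
  refine (abs_add_three _ _ _).trans ?_
  linarith

/-- If the adjacency matrix is close to `q` in cut norm and the degrees are close on average to
`n * D i`, with `D` bounded below, then the total bias is close to the corresponding expression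
in `q` and `D`. The error from replacing `(degree i)⁻¹` by `(n * D i)⁻¹` is controlled by the bound
`n²` on the triangle weights, so that vertices of atypically small degree are harmless. -/
theorem sum_triangleBias_approx {n : ℕ} (hn : 1 ≤ n) (G : SimpleGraph (Fin n))
    {A : Fin n → Fin n → ℝ} (hA : ∀ i j, A i j = open Classical in G.adjMatrix ℝ i j)
    {q : Fin n → Fin n → ℝ} (hq : ∀ i j, q i j ∈ Set.Icc (0 : ℝ) 1)
    {D : Fin n → ℝ} {c : ℝ} (hc : 0 < c) (hc1 : c ≤ 1) (hD : ∀ i, c ≤ D i) {η : ℝ}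
    (hcut : CutBound (fun i j => A i j - q i j) η)
    (hdeg : ∑ i, |∑ j, A i j - n * D i| ≤ η * (n : ℝ) ^ 2) :
    |∑ i, triangleBias G i
      - ∑ j, ((n : ℝ)⁻¹ * ∑ i, ((D i)⁻¹ * q i j - 1)) * (triangleWeight q j / 2)|
      ≤ 5 / (2 * c) * η * (n : ℝ) ^ 3 := by
  classical
  have hn0 : (0 : ℝ) < n := by exact_mod_cast hn
  have hA01 : ∀ i j, A i j ∈ Set.Icc (0 : ℝ) 1 := fun i j => by
    rw [hA, SimpleGraph.adjMatrix_apply]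
    split_ifs <;> simp
  have hA1 : ∀ i j, |A i j| ≤ 1 := fun i j => by
    rw [abs_of_nonneg (hA01 i j).1]
    exact (hA01 i j).2
  have hq1 : ∀ i j, |q i j| ≤ 1 := fun i j => by
    rw [abs_of_nonneg (hq i j).1]
    exact (hq i j).2
  have hDpos : ∀ i, 0 < D i := fun i => hc.trans_le (hD i)
  have ht : ∀ j, (triangleCount G j : ℝ) = triangleWeight A j / 2 := fun j => by
    have := sum_adj_triangle_eq G j
    simp only [triangleWeight, hA]
    rw [eq_div_iff two_ne_zero, mul_comm]
    convert this.symm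
  have hd : ∀ i, (G.degree i : ℝ) = ∑ j, A i j := fun i => by
    simp only [hA, SimpleGraph.adjMatrix_apply, Finset.sum_boole]
    norm_cast
    rw [← SimpleGraph.card_neighborFinset_eq_degree]
    congr 1
    ext j
    simp
  -- The bias with `(degree i)⁻¹` replaced by `(n * D i)⁻¹`.
  have step1 : ∀ i, |triangleBias G i - (((n : ℝ) * D i)⁻¹ * ∑ j, A i j * (triangleWeight A j / 2)
      - triangleWeight A i / 2)| ≤ |∑ j, A i j - n * D i| * (n / (2 * c)) := by
    intro i
    set s := ∑ j, A i j * (triangleWeight A j / 2) with hs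
    have hs0 : 0 ≤ s := Finset.sum_nonneg fun j _ => mul_nonneg (hA01 i j).1
      (div_nonneg (triangleWeight_mem hA01 j).1 zero_le_two)
    have hsd : s ≤ (∑ j, A i j) * ((n : ℝ) ^ 2 / 2) := by
      rw [Finset.sum_mul]
      refine Finset.sum_le_sum fun j _ => mul_le_mul_of_nonneg_left ?_ (hA01 i j).1
      have := (triangleWeight_mem hA01 j).2
      linarith
    have hti : (∑ j, A i j) = 0 → triangleWeight A i = 0 := by
      intro h0
      have h0' := (Finset.sum_eq_zero_iff_of_nonneg fun j _ => (hA01 i j).1).1 h0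
      refine Finset.sum_eq_zero fun k _ => Finset.sum_eq_zero fun l _ => ?_
      simp [h0' k (Finset.mem_univ k)]
    have hnD : 0 < n * D i := mul_pos hn0 (hDpos i)
    rw [triangleBias]
    by_cases h0 : G.degree i = 0
    · have hz : ∑ j, A i j = 0 := by rw [← hd, h0]; simp
      have : s = 0 := le_antisymm (by simpa [hz] using hsd) hs0
      rw [if_pos h0, this, hti hz]
      simp only [mul_zero, zero_div, sub_zero, abs_zero]
      positivity
    · rw [if_neg h0, ht i, hd i]
      have hdp : 0 < ∑ j, A i j := by
        rw [← hd]
        exact_mod_cast Nat.pos_of_ne_zero h0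
      set d := ∑ j, A i j
      have e : d⁻¹ * ∑ j, G.adjMatrix ℝ i j * (triangleCount G j : ℝ) = d⁻¹ * s := by
        rw [hs]
        congr 1
        refine Finset.sum_congr rfl fun j _ => ?_
        rw [ht, hA]
      have e' : d⁻¹ * s - triangleWeight A i / 2
          - (((n : ℝ) * D i)⁻¹ * s - triangleWeight A i / 2)
          = -(d - n * D i) * (s / (d * (n * D i))) := by
        have := (hDpos i).ne'
        field_simp
        ring
      have hle : s / (d * (n * D i)) ≤ n / (2 * c) := by
        rw [div_le_div_iff₀ (by positivity) (by positivity)]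
        calc s * (2 * c) ≤ (d * ((n : ℝ) ^ 2 / 2)) * (2 * c) := by gcongr
          _ = n * (d * (n * c)) := by ring
          _ ≤ n * (d * (n * D i)) := by
            gcongr
            exact hD i
      have e'' : |d⁻¹ * ∑ j, G.adjMatrix ℝ i j * (triangleCount G j : ℝ) - triangleWeight A i / 2
          - (((n : ℝ) * D i)⁻¹ * s - triangleWeight A i / 2)| ≤ |d - n * D i| * (n / (2 * c)) := by
        rw [e, e', abs_mul, abs_neg]
        refine mul_le_mul_of_nonneg_left ?_ (abs_nonneg _)
        rwa [abs_of_nonneg (by positivity)]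
      convert e'' using 6
  set r : Fin n → ℝ := fun j => (n : ℝ)⁻¹ * ∑ i, (c * (D i)⁻¹ * A i j - c) with hr
  have hcD : ∀ i, c * (D i)⁻¹ ∈ Set.Icc (0 : ℝ) 1 := fun i => by
    have := hDpos i
    refine ⟨by positivity, ?_⟩
    rw [← div_eq_mul_inv, div_le_one this]
    exact hD i
  have hr1 : ∀ j, |r j| ≤ 1 := by
    intro j
    have : |∑ i, (c * (D i)⁻¹ * A i j - c)| ≤ n * 1 := abs_sum_le_card_mul fun i => by
      have h1 := mul_nonneg (hcD i).1 (hA01 i j).1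
      have h2 := mul_le_one₀ (hcD i).2 (hA01 i j).1 (hA01 i j).2
      rw [abs_le]
      constructor <;> linarith
    rw [hr, abs_mul, abs_of_nonneg (by positivity), inv_mul_le_iff₀ hn0]
    exact this
  have step2 := triangle_counting hA1 hq1 hcut hr1
  have step3 : |∑ j, r j * triangleWeight q j
      - ∑ j, ((n : ℝ)⁻¹ * ∑ i, (c * (D i)⁻¹ * q i j - c)) * triangleWeight q j|
      ≤ η * (n : ℝ) ^ 3 := by
    have h := hcut (fun i => c * (D i)⁻¹) (fun j => triangleWeight q j / (n : ℝ) ^ 2)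
      (fun i => by rw [abs_of_nonneg (hcD i).1]; exact (hcD i).2) (fun j => by
        have := triangleWeight_mem hq j
        rw [abs_of_nonneg (div_nonneg this.1 (by positivity)), div_le_one (by positivity)]
        exact this.2)
    have e : ∑ j, r j * triangleWeight q j
        - ∑ j, ((n : ℝ)⁻¹ * ∑ i, (c * (D i)⁻¹ * q i j - c)) * triangleWeight q j
        = n * ∑ i, ∑ j, c * (D i)⁻¹ * (triangleWeight q j / (n : ℝ) ^ 2) * (A i j - q i j) := by
      rw [Finset.sum_comm]
      simp only [hr, ← Finset.sum_sub_distrib, ← sub_mul, ← mul_sub, Finset.mul_sum,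
        Finset.sum_mul]
      refine Finset.sum_congr rfl fun j _ => Finset.sum_congr rfl fun i _ => ?_
      field_simp
      ring
    rw [e, abs_mul, abs_of_pos hn0]
    calc (n : ℝ) * _ ≤ n * (η * (n : ℝ) ^ 2) := by gcongr
      _ = η * (n : ℝ) ^ 3 := by ring
  have eX : ∑ i, (((n : ℝ) * D i)⁻¹ * ∑ j, A i j * (triangleWeight A j / 2)
      - triangleWeight A i / 2) = (2 * c)⁻¹ * ∑ j, r j * triangleWeight A j := by
    have e1 : ∀ j, (2 * c)⁻¹ * (r j * triangleWeight A j)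
        = (∑ i, ((n : ℝ) * D i)⁻¹ * (A i j * (triangleWeight A j / 2)))
          - triangleWeight A j / 2 := by
      intro j
      have e2 : ∑ i, ((n : ℝ) * D i)⁻¹ * (A i j * (triangleWeight A j / 2))
          = (∑ i, (D i)⁻¹ * A i j) * ((n : ℝ)⁻¹ * triangleWeight A j / 2) := by
        rw [Finset.sum_mul]
        refine Finset.sum_congr rfl fun i _ => ?_
        rw [mul_inv]
        ring
      rw [e2, hr]
      simp only [Finset.sum_sub_distrib, Finset.sum_const, Finset.card_univ, Fintype.card_fin,
        nsmul_eq_mul, mul_assoc, ← Finset.mul_sum]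
      field_simp
    rw [Finset.mul_sum, Finset.sum_congr rfl fun j _ => e1 j, Finset.sum_sub_distrib,
      Finset.sum_sub_distrib, Finset.sum_comm]
    simp only [Finset.mul_sum]
  have eY : ∑ j, ((n : ℝ)⁻¹ * ∑ i, ((D i)⁻¹ * q i j - 1)) * (triangleWeight q j / 2)
      = (2 * c)⁻¹ * ∑ j, ((n : ℝ)⁻¹ * ∑ i, (c * (D i)⁻¹ * q i j - c)) * triangleWeight q j := by
    rw [Finset.mul_sum]
    refine Finset.sum_congr rfl fun j _ => ?_
    have : ∑ i, (c * (D i)⁻¹ * q i j - c) = c * ∑ i, ((D i)⁻¹ * q i j - 1) := by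
      rw [Finset.mul_sum]
      exact Finset.sum_congr rfl fun i _ => by ring
    rw [this]
    field_simp
  have b1 : |∑ i, triangleBias G i - (2 * c)⁻¹ * ∑ j, r j * triangleWeight A j|
      ≤ η * (n : ℝ) ^ 2 * (n / (2 * c)) := by
    rw [← eX, ← Finset.sum_sub_distrib]
    refine (Finset.abs_sum_le_sum_abs _ _).trans ((Finset.sum_le_sum fun i _ => step1 i).trans ?_)
    rw [← Finset.sum_mul]
    gcongr
  have b2 : |(2 * c)⁻¹ * ∑ j, r j * triangleWeight A j - (2 * c)⁻¹ *
      ∑ j, ((n : ℝ)⁻¹ * ∑ i, (c * (D i)⁻¹ * q i j - c)) * triangleWeight q j|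
      ≤ (2 * c)⁻¹ * (3 * η * (n : ℝ) ^ 3 + η * (n : ℝ) ^ 3) := by
    rw [← mul_sub, abs_mul, abs_of_nonneg (by positivity : 0 ≤ (2 * c)⁻¹)]
    gcongr
    exact (abs_sub_le _ _ _).trans (add_le_add step2 step3)
  rw [eY]
  refine (abs_sub_le _ _ _).trans ((add_le_add b1 b2).trans (le_of_eq ?_))
  field_simp
  ring

/-! ### Concentration of the adjacency matrix in the cut norm -/

/-- The cut bound only has to be tested on vectors with entries in `{-1, 0, 1}`, because the bilinear
form is maximised at vectors of signs in each argument (`0` occurs as the sign of `0`). A one-sided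
bound suffices, by changing the sign of `s`. -/
theorem cutBound_of_sign {n : ℕ} {M : Fin n → Fin n → ℝ} {η : ℝ}
    (h : ∀ s t : Fin n → SignType,
      ∑ i, ∑ j, ((s i : ℝ) * (t j : ℝ)) * M i j ≤ η * (n : ℝ) ^ 2) : CutBound M η := by
  intro a b ha hb
  set s : Fin n → SignType := fun i => SignType.sign (∑ j, b j * M i j) with hs
  set t : Fin n → SignType := fun j => SignType.sign (∑ i, (s i : ℝ) * M i j) with ht
  calc |∑ i, ∑ j, a i * b j * M i j| = |∑ i, a i * ∑ j, b j * M i j| := by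
        simp only [Finset.mul_sum, mul_assoc]
    _ ≤ ∑ i, |∑ j, b j * M i j| := by
        refine (Finset.abs_sum_le_sum_abs _ _).trans (Finset.sum_le_sum fun i _ => ?_)
        rw [abs_mul]
        exact mul_le_of_le_one_left (abs_nonneg _) (ha i)
    _ = ∑ j, b j * ∑ i, (s i : ℝ) * M i j := by
        simp only [← sign_mul_self, Finset.mul_sum]
        rw [Finset.sum_comm]
        simp only [hs]
        refine Finset.sum_congr rfl fun j _ => Finset.sum_congr rfl fun i _ => ?_
        ring
    _ ≤ ∑ j, |∑ i, (s i : ℝ) * M i j| := by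
        refine Finset.sum_le_sum fun j _ => (le_abs_self _).trans ?_
        rw [abs_mul]
        exact mul_le_of_le_one_left (abs_nonneg _) (hb j)
    _ = ∑ i, ∑ j, ((s i : ℝ) * (t j : ℝ)) * M i j := by
        rw [Finset.sum_comm]
        simp only [← sign_mul_self, ht, Finset.mul_sum]
        refine Finset.sum_congr rfl fun j _ => Finset.sum_congr rfl fun i _ => ?_
        ring
    _ ≤ η * (n : ℝ) ^ 2 := h s t

theorem sum_sum_eq_sum_lt {n : ℕ} {M f : Fin n → Fin n → ℝ} (hM : ∀ i j, M i j = M j i)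
    (hM0 : ∀ i, M i i = 0) :
    ∑ i, ∑ j, f i j * M i j = ∑ e : {e : Fin n × Fin n // e.1 < e.2},
      (f e.1.1 e.1.2 + f e.1.2 e.1.1) * M e.1.1 e.1.2 := by
  have h1 : ∑ i, ∑ j, f i j * M i j = (∑ i, ∑ j, if i < j then f i j * M i j else 0)
      + ∑ i, ∑ j, if j < i then f i j * M i j else 0 := by
    simp only [← Finset.sum_add_distrib]
    refine Finset.sum_congr rfl fun i _ => Finset.sum_congr rfl fun j _ => ?_
    rcases lt_trichotomy i j with h | rfl | h
    · simp [h, h.le]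
    · simp [hM0]
    · simp [h, h.le]
  rw [h1, Finset.sum_comm (f := fun i j => if j < i then f i j * M i j else 0),
    ← Finset.sum_add_distrib]
  simp only [← Finset.sum_add_distrib]
  have h2 := Finset.sum_subtype (F := inferInstance) (p := fun e : Fin n × Fin n => e.1 < e.2)
    (Finset.univ.filter fun e => e.1 < e.2) (by simp)
    (fun e => (f e.1 e.2 + f e.2 e.1) * M e.1 e.2)
  rw [← h2, ← Fintype.sum_prod_type', Finset.sum_filter]
  refine Finset.sum_congr rfl fun e _ => ?_
  split_ifs
  · rw [hM e.2 e.1]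
    ring
  · simp

theorem summable_pow_mul_exp_neg_sq (b : ℝ) (hb : 1 ≤ b) {a : ℝ} (ha : 0 < a) :
    Summable fun n : ℕ => b ^ n * Real.exp (-(a * (n : ℝ) ^ 2)) := by
  refine Summable.of_norm_bounded_eventually_nat Real.summable_exp_neg_nat ?_
  have hb0 : 0 < b := by linarith
  have ht : Tendsto (fun n : ℕ => a * (n : ℝ)) atTop atTop :=
    tendsto_natCast_atTop_atTop.const_mul_atTop ha
  filter_upwards [ht.eventually_ge_atTop (Real.log b + 1)] with n hn
  rw [Real.norm_of_nonneg (by positivity)]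
  have : b ^ n = Real.exp (n * Real.log b) := by
    rw [mul_comm, Real.exp_mul, Real.exp_log hb0, Real.rpow_natCast]
  rw [this, ← Real.exp_add, Real.exp_le_exp]
  have h0 : (0 : ℝ) ≤ n := n.cast_nonneg
  nlinarith

section Concentration

variable {Ω : Type*} [MeasurableSpace Ω] {P : Measure Ω} [IsProbabilityMeasure P]

open Classical in
/-- Hoeffding's inequality for the bilinear form of the centred adjacency matrix. -/
theorem hoeffding_signed_sum {κ : Graphon} {n : ℕ} (hn : 2 ≤ n) {G : Ω → SimpleGraph (Fin n)}
    (hG : IsInhomogeneousRandomGraph κ n G P) (s t : Fin n → SignType) {η : ℝ} (hη : 0 ≤ η) :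
    P.real {ω | η * (n : ℝ) ^ 2 ≤ ∑ i, ∑ j, ((s i : ℝ) * (t j : ℝ)) *
      ((G ω).adjMatrix ℝ i j - P.real {ω | (G ω).Adj i j})}
      ≤ Real.exp (-(η ^ 2 / 8 * (n : ℝ) ^ 2)) := by
  set E : {e : Fin n × Fin n // e.1 < e.2} → Set Ω := fun e => {ω | (G ω).Adj e.1.1 e.1.2}
    with hE
  have hEm : ∀ e, MeasurableSet (E e) := fun e => hG.measurableSet_adj _ _
  set r : {e : Fin n × Fin n // e.1 < e.2} → ℝ := fun e =>
    (s e.1.1 : ℝ) * (t e.1.2 : ℝ) + (s e.1.2 : ℝ) * (t e.1.1 : ℝ) with hr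
  have hsign : ∀ x : SignType, |(x : ℝ)| ≤ 1 := by
    intro x
    cases x <;> simp
  have hr2 : ∀ e, |r e| ≤ 2 := fun e => by
    have h1 := abs_mul_le_one (hsign (s e.1.1)) (hsign (t e.1.2))
    have h2 := abs_mul_le_one (hsign (s e.1.2)) (hsign (t e.1.1))
    exact (abs_add_le _ _).trans (by linarith)
  set X : {e : Fin n × Fin n // e.1 < e.2} → Ω → ℝ := fun e =>
    (fun x : ℝ => r e * (x - P.real (E e))) ∘ (E e).indicator (fun _ => (1 : ℝ)) with hX
  have hind : iIndepFun X P :=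
    hG.indep.iIndepFun_indicator.comp (fun e x => r e * (x - P.real (E e)))
      fun e => by fun_prop
  have hmeas : ∀ e, Measurable (X e) := fun e => by
    have : Measurable ((E e).indicator (fun _ => (1 : ℝ))) := measurable_const.indicator (hEm e)
    exact (this.sub_const _).const_mul _
  have hsub : ∀ e, HasSubgaussianMGF (X e) 4 P := by
    intro e
    have hint : Integrable ((E e).indicator (fun _ => (1 : ℝ))) P :=
      (integrable_const _).indicator (hEm e)
    have h := hasSubgaussianMGF_of_mem_Icc_of_integral_eq_zero (μ := P) (X := X e) (a := -2)
      (b := 2) (hmeas e).aemeasurable (ae_of_all _ fun ω => ?_) ?_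
    · convert h using 1
      rw [← NNReal.coe_inj]
      simp only [NNReal.coe_pow, NNReal.coe_div, coe_nnnorm, Real.norm_eq_abs]
      norm_num
    · have hp0 : 0 ≤ P.real (E e) := measureReal_nonneg
      have hp1 : P.real (E e) ≤ 1 := measureReal_le_one
      have h1 : |(E e).indicator (fun _ => (1 : ℝ)) ω - P.real (E e)| ≤ 1 := by
        rw [abs_le]
        by_cases hω : ω ∈ E e
        · rw [Set.indicator_of_mem hω]
          constructor <;> linarith
        · rw [Set.indicator_of_notMem hω]
          constructor <;> linarith
      have h2 : |X e ω| ≤ 2 * 1 := by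
        simp only [hX, Function.comp_apply, abs_mul]
        gcongr
        exact hr2 e
      rw [Set.mem_Icc, ← abs_le]
      linarith
    · simp only [hX, Function.comp_apply]
      rw [integral_const_mul, integral_sub hint (integrable_const _),
        integral_indicator_const _ (hEm e)]
      simp
  have hsum : ∀ ω, ∑ i, ∑ j, ((s i : ℝ) * (t j : ℝ)) *
      ((G ω).adjMatrix ℝ i j - P.real {ω | (G ω).Adj i j}) = ∑ e, X e ω := by
    intro ω
    rw [sum_sum_eq_sum_lt (f := fun i j => (s i : ℝ) * (t j : ℝ))
      (M := fun i j => (G ω).adjMatrix ℝ i j - P.real {ω | (G ω).Adj i j})]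
    · refine Finset.sum_congr rfl fun e _ => ?_
      simp [hX, hE, hr, SimpleGraph.adjMatrix_apply, Set.indicator_apply]
    · intro i j
      simp [SimpleGraph.adjMatrix_apply, SimpleGraph.adj_comm]
    · simp
  simp only [hsum]
  refine (HasSubgaussianMGF.measure_sum_ge_le_of_iIndepFun hind (fun e _ => hsub e)
    (s := Finset.univ) (by positivity)).trans ?_
  rw [Real.exp_le_exp]
  set N := Fintype.card {e : Fin n × Fin n // e.1 < e.2} with hN
  have hN0 : 0 < N := Fintype.card_pos_iff.2
    ⟨⟨(⟨0, by omega⟩, ⟨1, by omega⟩), by simp [Fin.lt_def]⟩⟩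
  have hNn : (N : ℝ) ≤ (n : ℝ) ^ 2 := by
    have := Fintype.card_subtype_le fun e : Fin n × Fin n => e.1 < e.2
    rw [Fintype.card_prod, Fintype.card_fin] at this
    have h : N ≤ n ^ 2 := by rw [sq]; exact this
    exact_mod_cast h
  have hN0' : (0 : ℝ) < N := by exact_mod_cast hN0
  simp only [Finset.sum_const, Finset.card_univ, nsmul_eq_mul, NNReal.coe_mul,
    NNReal.coe_natCast, NNReal.coe_ofNat]
  rw [neg_div, neg_le_neg_iff, le_div_iff₀ (by positivity)]
  calc η ^ 2 / 8 * (n : ℝ) ^ 2 * (2 * (N * 4)) = η ^ 2 * (n : ℝ) ^ 2 * N := by ring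
    _ ≤ η ^ 2 * (n : ℝ) ^ 2 * (n : ℝ) ^ 2 := by gcongr
    _ = (η * (n : ℝ) ^ 2) ^ 2 := by ring

open Classical in
/-- Almost surely, the centred adjacency matrices tend to `0` in the cut norm. The `9 ^ n` pairs of
sign vectors are outweighed by the Hoeffding bound `exp (-η² n² / 8)`, so the union bound is
summable and the joint law of the graphs plays no role. -/
theorem ae_eventually_cutBound {κ : Graphon} {G : (n : ℕ) → Ω → SimpleGraph (Fin n)}
    (hG : ∀ n : ℕ, 1 ≤ n → IsInhomogeneousRandomGraph κ n (G n) P) {η : ℝ} (hη : 0 < η) :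
    ∀ᵐ ω ∂P, ∀ᶠ n : ℕ in atTop, CutBound (fun i j => (G n ω).adjMatrix ℝ i j
      - P.real {ω | (G n ω).Adj i j}) η := by
  set B : (n : ℕ) → (Fin n → SignType) × (Fin n → SignType) → Set Ω := fun n st =>
    {ω | η * (n : ℝ) ^ 2 ≤ ∑ i, ∑ j, ((st.1 i : ℝ) * (st.2 j : ℝ)) *
      ((G n ω).adjMatrix ℝ i j - P.real {ω | (G n ω).Adj i j})} with hB
  set S : ℕ → Set Ω := fun n => if 2 ≤ n then ⋃ st, B n st else ∅ with hS
  have hSn : ∀ n, P (S n) ≤ ENNReal.ofReal (9 ^ n * Real.exp (-(η ^ 2 / 8 * (n : ℝ) ^ 2))) := by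
    intro n
    by_cases hn : 2 ≤ n
    · simp only [hS, if_pos hn]
      refine (measure_iUnion_fintype_le P (B n)).trans ?_
      have hb : ∀ st ∈ Finset.univ, P (B n st)
          ≤ ENNReal.ofReal (Real.exp (-(η ^ 2 / 8 * (n : ℝ) ^ 2))) := fun st _ => by
        rw [← ofReal_measureReal]
        exact ENNReal.ofReal_le_ofReal
          (hoeffding_signed_sum hn (hG n (by omega)) st.1 st.2 hη.le)
      refine (Finset.sum_le_card_nsmul _ _ _ hb).trans (le_of_eq ?_)
      have hcard : Fintype.card SignType = 3 := rfl
      rw [Finset.card_univ, Fintype.card_prod, Fintype.card_fun, Fintype.card_fin, hcard,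
        ← mul_pow, nsmul_eq_mul, ENNReal.ofReal_mul (by positivity)]
      congr 1
      rw [ENNReal.ofReal_pow (by positivity)]
      norm_num
    · simp [hS, hn]
  have hfin : ∑' n, P (S n) ≠ ⊤ :=
    ne_top_of_le_ne_top
      (summable_pow_mul_exp_neg_sq 9 (by norm_num) (by positivity : 0 < η ^ 2 / 8)).tsum_ofReal_ne_top
      (ENNReal.tsum_le_tsum hSn)
  filter_upwards [ae_eventually_notMem hfin] with ω hω
  filter_upwards [hω, eventually_ge_atTop 2] with n hn hn2
  refine cutBound_of_sign fun s t => ?_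
  simp only [hS, if_pos hn2, Set.mem_iUnion, not_exists] at hn
  exact (not_le.1 (hn (s, t))).le

end Concentration

/-! ### Riemann sums over the grid -/

/-- The grid point `(i + 1) / n` of the unit interval. -/
noncomputable def gridPoint (n : ℕ) (i : Fin n) : unitInterval :=
  ⟨((i : ℕ) + 1 : ℝ) / n, by positivity, by
    refine div_le_one_of_le₀ ?_ n.cast_nonneg
    exact_mod_cast i.2⟩

/-- Rounding up to the grid: `x ↦ ⌈x n⌉ / n`. -/
noncomputable def gridCeil (n : ℕ) (x : unitInterval) : unitInterval :=
  ⟨(⌈(x : ℝ) * n⌉₊ : ℝ) / n, by positivity, by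
    refine div_le_one_of_le₀ ?_ n.cast_nonneg
    have : (x : ℝ) * n ≤ n := mul_le_of_le_one_left n.cast_nonneg x.2.2
    exact_mod_cast Nat.ceil_le.2 this⟩

theorem gridCeil_eq_gridPoint {n : ℕ} {x : unitInterval} {i : Fin n}
    (h : ⌈(x : ℝ) * n⌉₊ = (i : ℕ) + 1) : gridCeil n x = gridPoint n i := by
  apply Subtype.ext
  simp [gridCeil, gridPoint, h]

theorem measurable_gridCeil (n : ℕ) : Measurable (gridCeil n) := by
  refine Measurable.subtype_mk ?_
  have h : Measurable fun x : unitInterval => ⌈(x : ℝ) * n⌉₊ :=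
    Nat.measurable_ceil.comp (measurable_subtype_coe.mul_const _)
  exact ((measurable_from_top (f := fun k : ℕ => (k : ℝ))).comp h).div_const _

theorem dist_gridCeil_le {n : ℕ} (hn : 1 ≤ n) (x : unitInterval) :
    dist (gridCeil n x) x ≤ 1 / n := by
  have hn0 : (0 : ℝ) < n := by exact_mod_cast hn
  have h1 := Nat.le_ceil ((x : ℝ) * n)
  have h2 := Nat.ceil_lt_add_one (mul_nonneg x.2.1 n.cast_nonneg : 0 ≤ (x : ℝ) * n)
  rw [Subtype.dist_eq, Real.dist_eq]
  have e : ((gridCeil n x : unitInterval) : ℝ) - x = (⌈(x : ℝ) * n⌉₊ - x * n) / n := by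
    simp only [gridCeil]
    field_simp
  rw [e, abs_of_nonneg (div_nonneg (by linarith) hn0.le)]
  gcongr
  linarith

theorem tendsto_gridCeil (x : unitInterval) : Tendsto (fun n => gridCeil n x) atTop (𝓝 x) := by
  rw [tendsto_iff_dist_tendsto_zero]
  refine squeeze_zero' (Eventually.of_forall fun _ => dist_nonneg) ?_
    tendsto_one_div_atTop_nhds_zero_nat
  filter_upwards [eventually_ge_atTop 1] with n hn using dist_gridCeil_le hn x

/-- Averages over the grid are integrals of functions composed with `gridCeil`. -/
theorem integral_comp_gridCeil {n : ℕ} (hn : 1 ≤ n) (f : unitInterval → ℝ) :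
    ∫ x, f (gridCeil n x) = (n : ℝ)⁻¹ * ∑ i, f (gridPoint n i) := by
  have hn0 : (0 : ℝ) < n := by exact_mod_cast hn
  set lo : Fin n → unitInterval := fun i => ⟨((i : ℕ) : ℝ) / n, by positivity, by
    refine div_le_one_of_le₀ ?_ n.cast_nonneg
    exact_mod_cast i.2.le⟩ with hlo
  have hmem : ∀ (x : unitInterval) (i : Fin n),
      x ∈ Set.Ioc (lo i) (gridPoint n i) ↔ ⌈(x : ℝ) * n⌉₊ = (i : ℕ) + 1 := by
    intro x i
    rw [Nat.ceil_eq_iff (by omega), Set.mem_Ioc, ← Subtype.coe_lt_coe, ← Subtype.coe_le_coe]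
    simp only [hlo, gridPoint, div_lt_iff₀ hn0, le_div_iff₀ hn0]
    simp
  have hae : (fun x => f (gridCeil n x)) =ᵐ[volume] fun x =>
      ∑ i, (Set.Ioc (lo i) (gridPoint n i)).indicator (fun _ => f (gridPoint n i)) x := by
    have h0 : ∀ᵐ x : unitInterval, x ≠ 0 := by
      rw [ae_iff]
      simp
    filter_upwards [h0] with x hx
    have hx0 : 0 < (x : ℝ) := unitInterval.pos_iff_ne_zero.2 hx
    have hc1 : 0 < ⌈(x : ℝ) * n⌉₊ := Nat.ceil_pos.2 (mul_pos hx0 hn0)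
    have hc2 : ⌈(x : ℝ) * n⌉₊ ≤ n := Nat.ceil_le.2 (mul_le_of_le_one_left n.cast_nonneg x.2.2)
    set i : Fin n := ⟨⌈(x : ℝ) * n⌉₊ - 1, by omega⟩ with hi
    have hxi : ⌈(x : ℝ) * n⌉₊ = (i : ℕ) + 1 := by simp only [hi]; omega
    rw [Finset.sum_eq_single i, Set.indicator_of_mem ((hmem x i).2 hxi),
      gridCeil_eq_gridPoint hxi]
    · intro j _ hj
      refine Set.indicator_of_notMem (fun h => hj ?_) _
      have := (hmem x j).1 h
      exact Fin.ext (by omega)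
    · simp
  rw [integral_congr_ae hae, integral_finsetSum _ fun i _ =>
    (integrable_const _).indicator measurableSet_Ioc, Finset.mul_sum]
  refine Finset.sum_congr rfl fun i _ => ?_
  rw [integral_indicator_const _ measurableSet_Ioc, measureReal_def, unitInterval.volume_Ioc]
  have : ((gridPoint n i : unitInterval) : ℝ) - lo i = (n : ℝ)⁻¹ := by
    simp only [gridPoint, hlo]
    field_simp
    ring
  rw [this, ENNReal.toReal_ofReal (by positivity), smul_eq_mul]

theorem integral_prod_gridCeil {X : Type*} [TopologicalSpace X] [CompactSpace X]
    [MeasureSpace X] [OpensMeasurableSpace (unitInterval × X)]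
    [IsFiniteMeasure (volume : Measure X)] {n : ℕ} (hn : 1 ≤ n) {ψ : X → X} (hψ : Measurable ψ)
    {f : unitInterval × X → ℝ} (hf : Continuous f) :
    ∫ p : unitInterval × X, f (gridCeil n p.1, ψ p.2)
      = (n : ℝ)⁻¹ * ∑ i, ∫ x, f (gridPoint n i, ψ x) := by
  obtain ⟨C, hC⟩ := isCompact_univ.exists_bound_of_continuousOn hf.continuousOn
  have hint : Integrable (fun p : unitInterval × X => f (gridCeil n p.1, ψ p.2))
      (volume.prod volume) := by
    refine Integrable.of_bound (C := C) ?_ (ae_of_all _ fun p => hC _ (Set.mem_univ _))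
    exact (hf.measurable.comp (((measurable_gridCeil n).comp measurable_fst).prodMk
      (hψ.comp measurable_snd))).aestronglyMeasurable
  rw [Measure.volume_eq_prod, integral_prod _ hint]
  exact integral_comp_gridCeil hn fun t => ∫ x, f (t, ψ x)

/-- Convergence of four-dimensional Riemann sums of a continuous function. -/
theorem tendsto_riemannSum
    {H : unitInterval × unitInterval × unitInterval × unitInterval → ℝ} (hH : Continuous H) :
    Tendsto (fun n : ℕ => (n : ℝ)⁻¹ * ∑ i, ((n : ℝ)⁻¹ * ∑ j, ((n : ℝ)⁻¹ * ∑ k, ((n : ℝ)⁻¹ * ∑ l,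
      H (gridPoint n i, gridPoint n j, gridPoint n k, gridPoint n l))))) atTop
      (𝓝 (∫ p, H p)) := by
  have hm := measurable_gridCeil
  have hm2 : ∀ n, Measurable fun p : unitInterval × unitInterval =>
      (gridCeil n p.1, gridCeil n p.2) := fun n =>
    ((hm n).comp measurable_fst).prodMk ((hm n).comp measurable_snd)
  have hm3 : ∀ n, Measurable fun p : unitInterval × unitInterval × unitInterval =>
      (gridCeil n p.1, gridCeil n p.2.1, gridCeil n p.2.2) := fun n =>
    ((hm n).comp measurable_fst).prodMk ((hm2 n).comp measurable_snd)
  have hm4 : ∀ n, Measurable fun p : unitInterval × unitInterval × unitInterval × unitInterval =>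
      (gridCeil n p.1, gridCeil n p.2.1, gridCeil n p.2.2.1, gridCeil n p.2.2.2) := fun n =>
    ((hm n).comp measurable_fst).prodMk ((hm3 n).comp measurable_snd)
  obtain ⟨C, hC⟩ := isCompact_univ.exists_bound_of_continuousOn hH.continuousOn
  have hlim : Tendsto (fun n : ℕ => ∫ p : unitInterval × unitInterval × unitInterval ×
      unitInterval, H (gridCeil n p.1, gridCeil n p.2.1, gridCeil n p.2.2.1, gridCeil n p.2.2.2))
      atTop (𝓝 (∫ p, H p)) := by
    refine tendsto_integral_of_dominated_convergence (fun _ => C)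
      (fun n => (hH.measurable.comp (hm4 n)).aestronglyMeasurable) (integrable_const _)
      (fun n => ae_of_all _ fun p => hC _ (Set.mem_univ _)) (ae_of_all _ fun p => ?_)
    exact (hH.tendsto p).comp ((tendsto_gridCeil _).prodMk_nhds ((tendsto_gridCeil _).prodMk_nhds
      ((tendsto_gridCeil _).prodMk_nhds (tendsto_gridCeil _))))
  refine hlim.congr' ?_
  filter_upwards [eventually_ge_atTop 1] with n hn
  rw [integral_prod_gridCeil hn (hm3 n) hH]
  congr 1
  refine Finset.sum_congr rfl fun i _ => ?_
  rw [integral_prod_gridCeil hn (hm2 n) (f := fun p => H (gridPoint n i, p)) (by fun_prop)]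
  congr 1
  refine Finset.sum_congr rfl fun j _ => ?_
  rw [integral_prod_gridCeil hn (hm n) (f := fun p => H (gridPoint n i, gridPoint n j, p))
    (by fun_prop)]
  congr 1
  refine Finset.sum_congr rfl fun k _ => ?_
  exact integral_comp_gridCeil hn fun t => H (gridPoint n i, gridPoint n j, gridPoint n k, t)

/-! ### The limiting bias as an integral over four points -/

namespace Graphon

variable {κ : Graphon}

theorem val_mem_Icc (κ : Graphon) (x y : unitInterval) : κ.val x y ∈ Set.Icc (0 : ℝ) 1 :=
  (κ.toFun x y).2

theorem continuous_val (h : Continuous (Function.uncurry κ.toFun)) :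
    Continuous fun p : unitInterval × unitInterval => κ.val p.1 p.2 :=
  continuous_subtype_val.comp h

theorem continuous_integral {X Y : Type*} [TopologicalSpace X] [FirstCountableTopology X]
    [LocallyCompactSpace X] [TopologicalSpace Y] [CompactSpace Y] [MeasureSpace Y]
    [OpensMeasurableSpace Y] [IsFiniteMeasure (volume : Measure Y)] {f : X → Y → ℝ}
    (hf : Continuous (Function.uncurry f)) : Continuous fun x => ∫ y, f x y := by
  have := continuous_parametric_integral_of_continuous (μ := (volume : Measure Y)) hf
    isCompact_univ
  simpa using this

theorem continuous_degreeDensity (h : Continuous (Function.uncurry κ.toFun)) :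
    Continuous κ.degreeDensity :=
  continuous_integral (continuous_val h)

theorem continuous_triangleKernel (h : Continuous (Function.uncurry κ.toFun)) :
    Continuous fun p : unitInterval × unitInterval × unitInterval =>
      κ.val p.1 p.2.1 * κ.val p.2.1 p.2.2 * κ.val p.2.2 p.1 := by
  have hv := continuous_val h
  exact ((hv.comp (by fun_prop : Continuous fun p : unitInterval × unitInterval × unitInterval =>
    (p.1, p.2.1))).mul (hv.comp (by fun_prop : Continuous
    fun p : unitInterval × unitInterval × unitInterval => (p.2.1, p.2.2)))).mul
    (hv.comp (by fun_prop : Continuous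
    fun p : unitInterval × unitInterval × unitInterval => (p.2.2, p.1)))

theorem continuous_triangleDensity (h : Continuous (Function.uncurry κ.toFun)) :
    Continuous κ.triangleDensity :=
  continuous_const.mul (continuous_integral (X := unitInterval)
    (f := fun x (p : unitInterval × unitInterval) =>
      κ.val x p.1 * κ.val p.1 p.2 * κ.val p.2 x) (continuous_triangleKernel h))

theorem degreeDensity_le_one (κ : Graphon) (x : unitInterval) : κ.degreeDensity x ≤ 1 := by
  have h : ‖κ.degreeDensity x‖ ≤ 1 * (volume : Measure unitInterval).real Set.univ :=
    norm_integral_le_of_norm_le_const (ae_of_all _ fun y => by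
      rw [Real.norm_of_nonneg (κ.val_mem_Icc x y).1]
      exact (κ.val_mem_Icc x y).2)
  simpa using (le_abs_self _).trans h

/-- The integrand of `χ^T` written as a function of a vertex, a neighbour of it, and the two other
vertices of a triangle at the neighbour. -/
noncomputable def biasKernel (κ : Graphon)
    (p : unitInterval × unitInterval × unitInterval × unitInterval) : ℝ :=
  ((κ.degreeDensity p.1)⁻¹ * κ.val p.1 p.2.1 - 1) *
    (κ.val p.2.1 p.2.2.1 * κ.val p.2.2.1 p.2.2.2 * κ.val p.2.2.2 p.2.1 / 2)

theorem continuous_biasKernel (h : Continuous (Function.uncurry κ.toFun))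
    (hpos : ∀ x, 0 < κ.degreeDensity x) : Continuous κ.biasKernel := by
  have h1 : Continuous fun p : unitInterval × unitInterval × unitInterval × unitInterval =>
      (κ.degreeDensity p.1)⁻¹ :=
    ((continuous_degreeDensity h).comp continuous_fst).inv₀ fun p => (hpos p.1).ne'
  have h2 : Continuous fun p : unitInterval × unitInterval × unitInterval × unitInterval =>
      κ.val p.1 p.2.1 :=
    (continuous_val h).comp (by fun_prop :
      Continuous fun p : unitInterval × unitInterval × unitInterval × unitInterval => (p.1, p.2.1))
  exact ((h1.mul h2).sub continuous_const).mul
    (((continuous_triangleKernel h).comp continuous_snd).div_const 2)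

/-- The term `-1` of the kernel accounts for `∫ T(x) dx`: as `[0,1]` has measure `1`, this integral may
be taken over the neighbour coordinate. -/
theorem chiT_eq_integral_biasKernel (h : Continuous (Function.uncurry κ.toFun))
    (hpos : ∀ x, 0 < κ.degreeDensity x) : κ.chiT = ∫ p, κ.biasKernel p := by
  have hint : ∀ {X : Type} [TopologicalSpace X] [CompactSpace X] [MeasureSpace X]
      [OpensMeasurableSpace X] [IsFiniteMeasure (volume : Measure X)] {f : X → ℝ},
      Continuous f → Integrable f := by
    intro X _ _ _ _ _ f hf
    obtain ⟨C, hC⟩ := isCompact_univ.exists_bound_of_continuousOn hf.continuousOn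
    exact Integrable.of_bound hf.measurable.aestronglyMeasurable C
      (ae_of_all _ fun p => hC _ (Set.mem_univ _))
  have hT := continuous_triangleDensity h
  have hκT : Continuous (Function.uncurry fun x y => κ.val x y * κ.triangleDensity y) :=
    (continuous_val h).mul (hT.comp continuous_snd)
  have hH := continuous_biasKernel h hpos
  have inner : ∀ x y, ∫ p : unitInterval × unitInterval, κ.biasKernel (x, y, p)
      = (κ.degreeDensity x)⁻¹ * (κ.val x y * κ.triangleDensity y) - κ.triangleDensity y := by
    intro x y
    simp only [biasKernel]
    rw [integral_const_mul, integral_div, triangleDensity]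
    ring
  have mid : ∀ x, ∫ p : unitInterval × unitInterval × unitInterval, κ.biasKernel (x, p)
      = (κ.degreeDensity x)⁻¹ * (∫ y, κ.val x y * κ.triangleDensity y)
        - ∫ y, κ.triangleDensity y := by
    intro x
    have hc : Continuous fun p : unitInterval × unitInterval × unitInterval =>
      κ.biasKernel (x, p) := by fun_prop
    rw [Measure.volume_eq_prod, integral_prod _ (hint hc)]
    have hκTx : Continuous fun y => κ.val x y * κ.triangleDensity y :=
      hκT.comp (by fun_prop : Continuous fun y => (x, y))
    simp only [inner]
    rw [integral_sub ((hint hκTx).const_mul _) (hint hT), integral_const_mul]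
  have hA : Integrable fun x => (κ.degreeDensity x)⁻¹ *
      (∫ y, κ.val x y * κ.triangleDensity y) :=
    hint (((continuous_degreeDensity h).inv₀ fun x => (hpos x).ne').mul
      (continuous_integral hκT))
  rw [Measure.volume_eq_prod, integral_prod _ (hint hH)]
  simp only [mid]
  rw [integral_sub hA (integrable_const _), chiT, integral_sub hA (hint hT)]
  simp

/-- Uniform continuity: rounding one or both arguments to the grid changes a continuous graphon
uniformly little. -/
theorem eventually_val_gridCeil (h : Continuous (Function.uncurry κ.toFun)) {δ : ℝ}
    (hδ : 0 < δ) : ∀ᶠ n : ℕ in atTop, ∀ x y,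
      |κ.val x y - κ.val (gridCeil n x) (gridCeil n y)| ≤ δ ∧
      |κ.val x (gridCeil n y) - κ.val x y| ≤ δ := by
  have hu := CompactSpace.uniformContinuous_of_continuous (continuous_val h)
  obtain ⟨ρ, hρ, hρδ⟩ := Metric.uniformContinuous_iff.1 hu δ hδ
  have ht := (tendsto_one_div_atTop_nhds_zero_nat (𝕜 := ℝ)).eventually_lt_const hρ
  filter_upwards [ht, eventually_ge_atTop 1] with n hn hn1 x y
  have hx := (dist_gridCeil_le hn1 x).trans_lt hn
  have hy := (dist_gridCeil_le hn1 y).trans_lt hn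
  constructor
  · refine (hρδ (a := (x, y)) (b := (gridCeil n x, gridCeil n y)) ?_).le
    rw [dist_comm, Prod.dist_eq]
    exact max_lt hx hy
  · refine (hρδ (a := (x, gridCeil n y)) (b := (x, y)) ?_).le
    rw [Prod.dist_eq]
    exact max_lt (by simpa using hρ) hy

end Graphon

/-! ### The almost sure limit -/

theorem CutBound.add_of_abs_le {n : ℕ} (hn : 1 ≤ n) {M N : Fin n → Fin n → ℝ} {η δ : ℝ}
    (h : CutBound M η) (hN : ∀ i j, |N i j| ≤ δ + if i = j then 1 else 0) :
    CutBound (fun i j => M i j + N i j) (η + δ + 1 / n) := by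
  intro a b ha hb
  have hn0 : (0 : ℝ) < n := by exact_mod_cast hn
  have hNsum : |∑ i, ∑ j, a i * b j * N i j| ≤ n * (n * δ + 1) := by
    refine abs_sum_le_card_mul fun i => (Finset.abs_sum_le_sum_abs _ _).trans ?_
    calc ∑ j, |a i * b j * N i j| ≤ ∑ j, (δ + if i = j then 1 else 0) := by
          refine Finset.sum_le_sum fun j _ => ?_
          rw [abs_mul]
          exact (mul_le_of_le_one_left (abs_nonneg _)
            (abs_mul_le_one (ha i) (hb j))).trans (hN i j)
      _ = n * δ + 1 := by simp [Finset.sum_add_distrib]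
  have e : ∑ i, ∑ j, a i * b j * (M i j + N i j)
      = ∑ i, ∑ j, a i * b j * M i j + ∑ i, ∑ j, a i * b j * N i j := by
    simp only [mul_add, Finset.sum_add_distrib]
  rw [e]
  refine (abs_add_le _ _).trans ((add_le_add (h a b ha hb) hNsum).trans (le_of_eq ?_))
  field_simp
  ring

theorem abs_sum_val_sub_degreeDensity_le {κ : Graphon}
    (h : Continuous (Function.uncurry κ.toFun)) {n : ℕ} (hn : 1 ≤ n) {δ : ℝ}
    (hδ : ∀ x y, |κ.val x (gridCeil n y) - κ.val x y| ≤ δ) (x : unitInterval) :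
    |∑ j, κ.val x (gridPoint n j) - n * κ.degreeDensity x| ≤ n * δ := by
  have hn0 : (0 : ℝ) < n := by exact_mod_cast hn
  have hc : Continuous fun y => κ.val x y :=
    (Graphon.continuous_val h).comp (by fun_prop : Continuous fun y => (x, y))
  have hb : ∀ y, ‖κ.val x y‖ ≤ 1 := fun y => by
    rw [Real.norm_of_nonneg (κ.val_mem_Icc x y).1]
    exact (κ.val_mem_Icc x y).2
  have hi1 : Integrable fun y => κ.val x y :=
    Integrable.of_bound hc.measurable.aestronglyMeasurable 1 (ae_of_all _ hb)
  have hi2 : Integrable fun y => κ.val x (gridCeil n y) :=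
    Integrable.of_bound (hc.measurable.comp (measurable_gridCeil n)).aestronglyMeasurable 1
      (ae_of_all _ fun y => hb _)
  have e : ∑ j, κ.val x (gridPoint n j) - n * κ.degreeDensity x
      = n * ∫ y, (κ.val x (gridCeil n y) - κ.val x y) := by
    rw [integral_sub hi2 hi1, integral_comp_gridCeil hn fun y => κ.val x y,
      Graphon.degreeDensity, mul_sub, mul_inv_cancel_left₀ hn0.ne']
  rw [e, abs_mul, abs_of_pos hn0]
  gcongr
  have := norm_integral_le_of_norm_le_const (μ := (volume : Measure unitInterval))
    (f := fun y => κ.val x (gridCeil n y) - κ.val x y) (ae_of_all _ (hδ x))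
  simpa using this

/-- The graphs `G(n, κ)`, `n ≥ 1`, may be coupled in an arbitrary way on the common probability
space. -/
theorem theorem1p11 (κ : Graphon) (hcont : Continuous (Function.uncurry κ.toFun))
    (hpos : ∀ x : unitInterval, 0 < κ.degreeDensity x)
    {Ω : Type*} [MeasurableSpace Ω] (P : Measure Ω) [IsProbabilityMeasure P]
    (G : (n : ℕ) → Ω → SimpleGraph (Fin n))
    (hG : ∀ n : ℕ, 1 ≤ n → IsInhomogeneousRandomGraph κ n (G n) P) :
    ∀ᵐ ω ∂P, Tendsto (fun n : ℕ => (n : ℝ) ^ (-2 : ℤ) * avgTriangleBias (G n ω)) atTop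
      (𝓝 κ.chiT) := by
  classical
  obtain ⟨x₀, -, hx₀'⟩ := isCompact_univ.exists_isMinOn Set.univ_nonempty
    (Graphon.continuous_degreeDensity hcont).continuousOn
  have hx₀ : ∀ x, κ.degreeDensity x₀ ≤ κ.degreeDensity x := fun x => hx₀' (Set.mem_univ x)
  set c := κ.degreeDensity x₀ with hc
  have hcpos : 0 < c := hpos x₀
  have hae : ∀ᵐ ω ∂P, ∀ m : ℕ, ∀ᶠ n : ℕ in atTop, CutBound (fun i j =>
      (G n ω).adjMatrix ℝ i j - P.real {ω | (G n ω).Adj i j}) (1 / ((m : ℝ) + 1)) :=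
    ae_all_iff.2 fun m => ae_eventually_cutBound hG (by positivity)
  filter_upwards [hae] with ω hω
  set Z : ℕ → ℝ := fun n => ∑ j, ((n : ℝ)⁻¹ * ∑ i, ((κ.degreeDensity (gridPoint n i))⁻¹ *
    κ.val (gridPoint n i) (gridPoint n j) - 1)) *
    (triangleWeight (fun i j => κ.val (gridPoint n i) (gridPoint n j)) j / 2) with hZ
  have hZlim : Tendsto (fun n : ℕ => ((n : ℝ) ^ 3)⁻¹ * Z n) atTop (𝓝 κ.chiT) := by
    rw [Graphon.chiT_eq_integral_biasKernel hcont hpos]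
    refine (tendsto_riemannSum (Graphon.continuous_biasKernel hcont hpos)).congr fun n => ?_
    simp only [hZ, Graphon.biasKernel, Finset.mul_sum, Finset.sum_mul]
    simp only [triangleWeight, Finset.mul_sum, Finset.sum_div]
    rw [Finset.sum_comm]
    refine Finset.sum_congr rfl fun j _ => Finset.sum_congr rfl fun i _ => ?_
    refine Finset.sum_congr rfl fun k _ => Finset.sum_congr rfl fun l _ => ?_
    simp only [← inv_pow]
    ring
  have hdiff : Tendsto (fun n : ℕ => (n : ℝ) ^ (-2 : ℤ) * avgTriangleBias (G n ω)
      - ((n : ℝ) ^ 3)⁻¹ * Z n) atTop (𝓝 0) := by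
    rw [Metric.tendsto_nhds]
    intro ε hε
    -- The errors below add up to `4 * δ` in the hypotheses of `sum_triangleBias_approx`.
    set δ := ε * c / 20 with hδ
    have hδ0 : 0 < δ := by positivity
    obtain ⟨m, hm⟩ := exists_nat_one_div_lt hδ0
    have ht := (tendsto_one_div_atTop_nhds_zero_nat (𝕜 := ℝ)).eventually_lt_const hδ0
    filter_upwards [hω m, Graphon.eventually_val_gridCeil hcont hδ0, ht, eventually_ge_atTop 1]
      with n hcut hval hn hn1
    have hn0 : (0 : ℝ) < n := by exact_mod_cast hn1
    set q : Fin n → Fin n → ℝ := fun i j => κ.val (gridPoint n i) (gridPoint n j) with hq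
    have hlt : ∀ i j : Fin n, i < j → |P.real {ω | (G n ω).Adj i j} - q i j| ≤ δ := by
      intro i j hij
      obtain ⟨x, y, hx, hy, hp⟩ := (hG n hn1).edge_prob i j hij
      rw [measureReal_def, hp, ENNReal.toReal_ofReal (κ.val_mem_Icc x y).1, hq]
      have := (hval x y).1
      rwa [gridCeil_eq_gridPoint hx, gridCeil_eq_gridPoint hy] at this
    have hq_symm : ∀ i j, q i j = q j i := fun i j => by
      simp only [hq, Graphon.val, κ.symm_toFun (gridPoint n i)]
    have hpq : ∀ i j : Fin n, |P.real {ω | (G n ω).Adj i j} - q i j|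
        ≤ δ + if i = j then 1 else 0 := by
      intro i j
      rcases lt_trichotomy i j with h | rfl | h
      · simpa [h.ne] using hlt i j h
      · have h01 := κ.val_mem_Icc (gridPoint n i) (gridPoint n i)
        have : |q i i| ≤ 1 := by
          rw [abs_of_nonneg h01.1]
          exact h01.2
        simp only [SimpleGraph.irrefl, Set.ofPred_false, measureReal_empty, zero_sub, abs_neg,
          if_true]
        linarith
      · have := hlt j i h
        rw [hq_symm]
        simp only [SimpleGraph.adj_comm _ i j]
        simpa [h.ne'] using this
    have hcutq : CutBound (fun i j => (G n ω).adjMatrix ℝ i j - q i j)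
        (1 / ((m : ℝ) + 1) + δ + 1 / n) := by
      have := hcut.add_of_abs_le hn1 hpq
      simpa only [sub_add_sub_cancel] using this
    have hcutq' : CutBound (fun i j => (G n ω).adjMatrix ℝ i j - q i j) (4 * δ) := by
      intro a b ha hb
      refine (hcutq a b ha hb).trans ?_
      gcongr
      linarith
    have hdeg : ∑ i, |∑ j, (G n ω).adjMatrix ℝ i j - n * κ.degreeDensity (gridPoint n i)|
        ≤ 4 * δ * (n : ℝ) ^ 2 := by
      have h1 := hcutq.row_sums
      have h2 : ∀ i, |∑ j, (G n ω).adjMatrix ℝ i j - n * κ.degreeDensity (gridPoint n i)|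
          ≤ |∑ j, ((G n ω).adjMatrix ℝ i j - q i j)| + n * δ := fun i => by
        have h3 := abs_sum_val_sub_degreeDensity_le hcont hn1 (fun x y => (hval x y).2)
          (gridPoint n i)
        rw [Finset.sum_sub_distrib]
        exact (abs_sub_le _ (∑ j, q i j) _).trans (by gcongr)
      calc _ ≤ ∑ i, (|∑ j, ((G n ω).adjMatrix ℝ i j - q i j)| + n * δ) :=
            Finset.sum_le_sum fun i _ => h2 i
        _ = ∑ i, |∑ j, ((G n ω).adjMatrix ℝ i j - q i j)| + n * (n * δ) := by
            simp [Finset.sum_add_distrib]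
        _ ≤ (1 / ((m : ℝ) + 1) + δ + 1 / n) * (n : ℝ) ^ 2 + n * (n * δ) := by gcongr
        _ = (1 / ((m : ℝ) + 1) + δ + 1 / n + δ) * (n : ℝ) ^ 2 := by ring
        _ ≤ 4 * δ * (n : ℝ) ^ 2 := by
            gcongr
            linarith
    have key := sum_triangleBias_approx hn1 (G n ω) (A := fun i j => (G n ω).adjMatrix ℝ i j)
      (fun i j => by congr!) (q := q) (fun i j => κ.val_mem_Icc _ _)
      (D := fun i => κ.degreeDensity (gridPoint n i)) hcpos (κ.degreeDensity_le_one x₀)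
      (fun i => hx₀ _) hcutq' hdeg
    rw [Real.dist_eq, sub_zero]
    have e : (n : ℝ) ^ (-2 : ℤ) * avgTriangleBias (G n ω) - ((n : ℝ) ^ 3)⁻¹ * Z n
        = ((n : ℝ) ^ 3)⁻¹ * (∑ i, triangleBias (G n ω) i - Z n) := by
      rw [avgTriangleBias, zpow_neg, mul_sub, ← mul_assoc, ← mul_inv]
      norm_cast
    rw [e, abs_mul, abs_of_pos (by positivity)]
    calc ((n : ℝ) ^ 3)⁻¹ * |∑ i, triangleBias (G n ω) i - Z n|
        ≤ ((n : ℝ) ^ 3)⁻¹ * (5 / (2 * c) * (4 * δ) * (n : ℝ) ^ 3) := by gcongr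
      _ = ε / 2 := by
        rw [hδ]
        field_simp
        norm_num
      _ < ε := by linarith
  have := hdiff.add hZlim
  simpa using this
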